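/- Let $J_0, Y_0$ be the Bessel functions of the first and second kind of order zero, $H_0^{(1)}=J_0+\mathrm{i}Y_0$ the Hankel function, and $H_0(t):=\mathrm{i}H_0^{(1)}(\mathrm{i}t)$ for $t>0$ (a real number). Let $a>0$ and $\tau\ge 6$, and put $k_0:=\frac{\pi}{30a}$. For integers $N\ge 1$ let $$\mathbb{K}_N:=\Big\{\tfrac{\pi}{a}|\boldsymbol l| : \boldsymbol l\in\mathbb{Z}^2,\ 1\le|\boldsymbol l|_\infty\le N\Big\}\cup\{k_0\}.$$ For $k\in\mathbb{K}_N$ put $$R=\tau a,\quad \lambda_1=\tfrac12,\quad \lambda_2=\tfrac12+\tfrac{\pi}{2kR}\quad\text{if }k\neq k_0;\qquad R=6a,\quad \lambda_1=\tfrac12,\quad \lambda_2=-\tfrac32\quad\text{if }k=k_0.$$ For an integer $m\ge 10$ and $j\in\{1,\dots,m\}$ let $\vartheta_i=i\pi/m$, let $\Gamma_j=\{R(\cos\vartheta,\sin\vartheta):\vartheta_{2j-2}\le\vartheta\le\vartheta_{2j}\}$, and let $z_{j,\ell}=\lambda_\ell R(\cos\vartheta_{2j-1},\sin\vartheta_{2j-1})$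 for $\ell=1,2$. For $x\in\Gamma_j$ and $\ell=1,2$ write $r_{j,\ell}=|x-z_{j,\ell}|$ and, for $\square\in\{\mathcal I,\Delta\}$ (identity or Laplacian), $$A_{j,\ell,k}^{\mathcal I}=\tfrac{1}{k^2}\big(Y_0(kr_{j,\ell})+H_0(kr_{j,\ell})\big),\quad B_{j,\ell,k}^{\mathcal I}=-\tfrac1{k^2}J_0(kr_{j,\ell}),\quad A_{j,\ell,k}^{\Delta}=H_0(kr_{j,\ell})-Y_0(kr_{j,\ell}),\quad B_{j,\ell,k}^{\Delta}=J_0(kr_{j,\ell}),$$ $$D_{j,k}^\square=\begin{bmatrix}A_{j,1,k}^\square & B_{j,1,k}^\square\\ A_{j,2,k}^\square & B_{j,2,k}^\square\end{bmatrix}.$$ Let $p=5$ if $\square=\mathcal I$ and $p=1$ if $\square=\Delta$. Then there is a constant $C>0$, depending only on $a$ and $\tau$, such that for both choices of $\square$, all integers $m\ge 10$ and $N\ge1$, all $k\in\mathbb{K}_N$, all $j\in\{1,\dots,m\}$ and all $x\in\Gamma_j$, $$\big|\det D_{j,k}^\square\big|\ge C\,k^{-p}.$$ Consequently, for all such $\square,m,N,k,j,x$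 and every right-hand side $(f_1,f_2)\in\mathbb{R}^2$, the phase-retrieval system $$A_{j,\ell,k}^\square\,\xi+B_{j,\ell,k}^\square\,\eta=f_\ell,\qquad \ell=1,2,$$ has exactly one solution $(\xi,\eta)\in\mathbb{R}^2$. -/

import Mathlib

noncomputable section

namespace PhaseRetrieval

/-- The Bessel function `J₀(z) = ∑ (-1)ⁿ (z/2)²ⁿ / (n!)²`. -/
def besselJ0 (z : ℂ) : ℂ :=
  ∑' n : ℕ, (-1) ^ n * (z ^ 2 / 4) ^ n / ((n.factorial : ℂ) ^ 2)

/-- The Bessel function of the second kind `Y₀` (principal branch):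
`Y₀(z) = (2/π) (log (z/2) + γ) J₀(z) - (2/π) ∑ (-1)ⁿ hₙ (z²/4)ⁿ / (n!)²`, where `γ` is the
Euler–Mascheroni constant and `hₙ = 1 + 1/2 + ⋯ + 1/n`. -/
def besselY0 (z : ℂ) : ℂ :=
  2 / (Real.pi : ℂ) * (Complex.log (z / 2) + (Real.eulerMascheroniConstant : ℂ)) * besselJ0 z
    - 2 / (Real.pi : ℂ) *
      ∑' n : ℕ, (-1) ^ n * ((harmonic n : ℚ) : ℂ) * (z ^ 2 / 4) ^ n / ((n.factorial : ℂ) ^ 2)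

/-- The Hankel function of the first kind and order zero, `H₀⁽¹⁾ = J₀ + i Y₀`. -/
def hankelH10 (z : ℂ) : ℂ := besselJ0 z + Complex.I * besselY0 z

/-- `J₀` on the positive half-line; the complex value there is real, see `besselJ0_ofReal`. -/
def J0 (t : ℝ) : ℝ := (besselJ0 t).re

/-- `Y₀` on the positive half-line; the complex value there is real, see `besselY0_ofReal`. -/
def Y0 (t : ℝ) : ℝ := (besselY0 t).re

/-- `H₀(t) = i H₀⁽¹⁾(i t)` on the positive half-line; the complex value there is real, see
`I_mul_hankelH10_I_mul`. -/
def H0 (t : ℝ) : ℝ := (Complex.I * hankelH10 (Complex.I * t)).re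

theorem besselJ0_im_of_sq_real {z : ℂ} {s : ℝ} (hz : z ^ 2 = (s : ℂ)) : (besselJ0 z).im = 0 := by
  have h : besselJ0 z = ((∑' n : ℕ, (-1) ^ n * (s / 4) ^ n / ((n.factorial : ℝ) ^ 2) : ℝ) : ℂ) := by
    rw [besselJ0, hz, Complex.ofReal_tsum]
    congr 1
    funext n
    push_cast
    rfl
  rw [h, Complex.ofReal_im]

theorem besselY0_tail_im_of_sq_real {z : ℂ} {s : ℝ} (hz : z ^ 2 = (s : ℂ)) :
    (∑' n : ℕ, (-1) ^ n * ((harmonic n : ℚ) : ℂ) * (z ^ 2 / 4) ^ n /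
      ((n.factorial : ℂ) ^ 2)).im = 0 := by
  have h : (∑' n : ℕ, (-1) ^ n * ((harmonic n : ℚ) : ℂ) * (z ^ 2 / 4) ^ n /
      ((n.factorial : ℂ) ^ 2)) =
      ((∑' n : ℕ, (-1) ^ n * ((harmonic n : ℚ) : ℝ) * (s / 4) ^ n /
        ((n.factorial : ℝ) ^ 2) : ℝ) : ℂ) := by
    rw [hz, Complex.ofReal_tsum]
    congr 1
    funext n
    push_cast
    rfl
  rw [h, Complex.ofReal_im]

theorem besselJ0_ofReal (t : ℝ) : besselJ0 (t : ℂ) = (J0 t : ℂ) := by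
  apply Complex.ext
  · simp [J0]
  · rw [Complex.ofReal_im]
    exact besselJ0_im_of_sq_real (s := t ^ 2) (by push_cast; rfl)

theorem besselY0_ofReal {t : ℝ} (ht : 0 < t) : besselY0 (t : ℂ) = (Y0 t : ℂ) := by
  apply Complex.ext
  · simp [Y0]
  · have hz : (t : ℂ) ^ 2 = ((t ^ 2 : ℝ) : ℂ) := by push_cast; rfl
    have h1 := besselJ0_im_of_sq_real hz
    have h2 := besselY0_tail_im_of_sq_real hz
    have hl : Complex.log ((t : ℂ) / 2) = ((Real.log (t / 2) : ℝ) : ℂ) := by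
      rw [Complex.ofReal_log (by positivity)]
      push_cast
      rfl
    have hp : (2 / (Real.pi : ℂ)) = ((2 / Real.pi : ℝ) : ℂ) := by push_cast; rfl
    rw [besselY0, hl, hp, Complex.ofReal_im]
    simp only [Complex.sub_im, Complex.mul_im, Complex.mul_re, Complex.add_im, Complex.add_re,
      Complex.ofReal_im, Complex.ofReal_re, h1, h2]
    ring

theorem I_mul_hankelH10_I_mul {t : ℝ} (ht : 0 < t) :
    Complex.I * hankelH10 (Complex.I * (t : ℂ)) = (H0 t : ℂ) := by
  apply Complex.ext
  · simp [H0]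
  · have hz : (Complex.I * (t : ℂ)) ^ 2 = ((-t ^ 2 : ℝ) : ℂ) := by
      rw [mul_pow, Complex.I_sq]; push_cast; ring
    have h1 := besselJ0_im_of_sq_real hz
    have h2 := besselY0_tail_im_of_sq_real hz
    have hl : Complex.log (Complex.I * (t : ℂ) / 2)
        = ((Real.log (t / 2) : ℝ) : ℂ) + ((Real.pi / 2 : ℝ) : ℂ) * Complex.I := by
      have : Complex.I * (t : ℂ) / 2 = ((t / 2 : ℝ) : ℂ) * Complex.I := by push_cast; ring
      rw [this, Complex.log_ofReal_mul (by positivity) Complex.I_ne_zero, Complex.log_I]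
      push_cast
      rfl
    have hp : (2 / (Real.pi : ℂ)) = ((2 / Real.pi : ℝ) : ℂ) := by push_cast; rfl
    have hpi := Real.pi_ne_zero
    rw [hankelH10, besselY0, hl, hp, Complex.ofReal_im]
    simp only [Complex.sub_im, Complex.sub_re, Complex.mul_im, Complex.mul_re, Complex.add_im,
      Complex.add_re, Complex.ofReal_im, Complex.ofReal_re, Complex.I_re, Complex.I_im, h1, h2]
    field_simp
    ring

/-- The small wave number `k₀ = π / (30 a)`. -/
def k0 (a : ℝ) : ℝ := Real.pi / (30 * a)

/-- The admissible wave numbers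
`𝕂_N = {(π/a) |l| : l ∈ ℤ², 1 ≤ |l|_∞ ≤ N} ∪ {k₀}`, with `|l|` the Euclidean norm. -/
def admissible (a : ℝ) (N : ℕ) : Set ℝ :=
  {k | ∃ l₁ l₂ : ℤ, 1 ≤ max |l₁| |l₂| ∧ max |l₁| |l₂| ≤ (N : ℤ) ∧
    k = Real.pi / a * Real.sqrt ((l₁ : ℝ) ^ 2 + (l₂ : ℝ) ^ 2)} ∪ {k0 a}

/-- The measurement radius: `6 a` at `k = k₀`, and `τ a` at the other wave numbers. -/
def radius (a τ k : ℝ) : ℝ := if k = k0 a then 6 * a else τ * a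

/-- The position parameters `λ_{j,1}, λ_{j,2}` (they do not depend on `j`). -/
def lam (a τ k : ℝ) : Fin 2 → ℝ :=
  ![1 / 2, if k = k0 a then -3 / 2 else 1 / 2 + Real.pi / (2 * k * radius a τ k)]

/-- The angles `ϑ_i = i π / m`. -/
def theta (m : ℕ) (i : ℝ) : ℝ := i * Real.pi / m

/-- The point of the plane with polar coordinates `(r, ϑ)` (`r` may be negative). -/
def polar (r ϑ : ℝ) : EuclideanSpace ℝ (Fin 2) := !₂[r * Real.cos ϑ, r * Real.sin ϑ]

/-- The arc `Γ_j = {R (cos ϑ, sin ϑ) : ϑ_{2j-2} ≤ ϑ ≤ ϑ_{2j}}`. -/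
def arc (R : ℝ) (m j : ℕ) : Set (EuclideanSpace ℝ (Fin 2)) :=
  polar R '' Set.Icc (theta m (2 * j - 2)) (theta m (2 * j))

/-- The auxiliary source points `z_{j,ℓ} = λ_{j,ℓ} R (cos ϑ_{2j-1}, sin ϑ_{2j-1})`. -/
def source (a τ k : ℝ) (m j : ℕ) (ℓ : Fin 2) : EuclideanSpace ℝ (Fin 2) :=
  polar (lam a τ k ℓ * radius a τ k) (theta m (2 * j - 1))

/-- The choice of `□`: the identity or the Laplacian. -/
inductive Op
  | ident
  | laplacian

/-- The exponent `p`: `5` for the identity, `1` for the Laplacian. -/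
def Op.exponent : Op → ℕ
  | .ident => 5
  | .laplacian => 1

/-- The coefficient `A^□` at distance `r` from the source. -/
def coeffA (op : Op) (k r : ℝ) : ℝ :=
  match op with
  | .ident => 1 / k ^ 2 * (Y0 (k * r) + H0 (k * r))
  | .laplacian => H0 (k * r) - Y0 (k * r)

/-- The coefficient `B^□` at distance `r` from the source. -/
def coeffB (op : Op) (k r : ℝ) : ℝ :=
  match op with
  | .ident => -(1 / k ^ 2) * J0 (k * r)
  | .laplacian => J0 (k * r)

/-- The coefficient matrix `D_{j,k}^□` at the point `x`: its `ℓ`-th row is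
`(A_{j,ℓ,k}^□, B_{j,ℓ,k}^□)`, evaluated at `r_{j,ℓ} = |x - z_{j,ℓ}|`. -/
def coeffMatrix (op : Op) (a τ k : ℝ) (m j : ℕ) (x : EuclideanSpace ℝ (Fin 2)) :
    Matrix (Fin 2) (Fin 2) ℝ :=
  Matrix.of fun ℓ => ![coeffA op k (dist x (source a τ k m j ℓ)),
    coeffB op k (dist x (source a τ k m j ℓ))]

end PhaseRetrieval

end

/-!
Up to a power of `k`, both determinants equal `(H₀ + σ Y₀)(q) J₀(p) - (H₀ + σ Y₀)(p) J₀(q)` in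
absolute value, where `q = k r₁`, `p = k r₂` and `σ = ±1`.

For `k ≥ π / a` the contribution of `H₀ = (2/π) K₀` is negligible: the quotient `K₀ / I₀` decreases
to zero, and integrating its derivative `-1 / (t I₀²)` bounds `K₀` by `1 / (2 I₀)`. The remaining
part `J₀(q) Y₀(p) - Y₀(q) J₀(p)`, as a function of `p`, solves Bessel's equation and vanishes at `q`
with slope given by the Wronskian. The choice of `λ₂` makes `q - p` close to a quarter of a period,
where comparison with a sine keeps this function of size `1 / q`.

At `k = k₀` the two arguments lie in short explicit intervals, on which Taylor polynomials of the
power series of `J₀`, `I₀` and their logarithmic companions decide the sign and size.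
-/

noncomputable section

namespace PhaseRetrieval

open Real Set Filter Topology

section PowerSeries

variable {𝕜 : Type*} [RCLike 𝕜] {c : ℕ → 𝕜}

/-- The sum of the power series with coefficients `c`; as a `tsum`, it is `0` where the series
diverges. -/
def seriesSum (c : ℕ → 𝕜) (y : 𝕜) : 𝕜 := ∑' n, c n * y ^ n

/-- The coefficients of the termwise derivative of the power series with coefficients `c`. -/
def derivCoeff (c : ℕ → 𝕜) (n : ℕ) : 𝕜 := (n + 1) * c (n + 1)

/-- Coefficients dominated by those of the exponential series, so that the power series and all its
termwise derivatives converge everywhere. -/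
def ExpBounded (c : ℕ → 𝕜) : Prop := ∀ n, ‖c n‖ ≤ 1 / (n.factorial : ℝ)

theorem norm_derivCoeff (c : ℕ → 𝕜) (n : ℕ) : ‖derivCoeff c n‖ = (n + 1) * ‖c (n + 1)‖ := by
  rw [derivCoeff, norm_mul]
  norm_cast

namespace ExpBounded

protected theorem derivCoeff (hc : ExpBounded c) : ExpBounded (derivCoeff c) := fun n => calc
  ‖PhaseRetrieval.derivCoeff c n‖ = (n + 1) * ‖c (n + 1)‖ := norm_derivCoeff c n
  _ ≤ (n + 1) * (1 / ((n + 1).factorial : ℝ)) := by gcongr; exact hc (n + 1)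
  _ = 1 / (n.factorial : ℝ) := by rw [Nat.factorial_succ]; push_cast; field_simp

theorem norm_term_le (hc : ExpBounded c) (y : 𝕜) (n : ℕ) :
    ‖c n * y ^ n‖ ≤ ‖y‖ ^ n / (n.factorial : ℝ) := calc
  ‖c n * y ^ n‖ = ‖c n‖ * ‖y‖ ^ n := by rw [norm_mul, norm_pow]
  _ ≤ 1 / (n.factorial : ℝ) * ‖y‖ ^ n := by gcongr; exact hc n
  _ = ‖y‖ ^ n / (n.factorial : ℝ) := by ring

theorem hasSum (hc : ExpBounded c) (y : 𝕜) : HasSum (fun n => c n * y ^ n) (seriesSum c y) :=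
  (Summable.of_norm_bounded (Real.summable_pow_div_factorial ‖y‖) (hc.norm_term_le y)).hasSum

theorem hasDerivAt (hc : ExpBounded c) (y : 𝕜) :
    HasDerivAt (seriesSum c) (seriesSum (derivCoeff c) y) y := by
  set r := ‖y‖ + 1 with hr
  have : 0 < r := by positivity
  have hmajorant : Summable fun n : ℕ => ‖c n‖ * (n * r ^ (n - 1)) := by
    rw [← summable_nat_add_iff 1]
    refine (Real.summable_pow_div_factorial r).of_nonneg_of_le (fun n => by positivity) fun n => ?_
    calc ‖c (n + 1)‖ * (↑(n + 1) * r ^ (n + 1 - 1)) = ‖PhaseRetrieval.derivCoeff c n‖ * r ^ n := by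
          rw [norm_derivCoeff, Nat.add_sub_cancel]; push_cast; ring
      _ ≤ 1 / (n.factorial : ℝ) * r ^ n := by gcongr; exact hc.derivCoeff n
      _ = r ^ n / (n.factorial : ℝ) := by ring
  have hbound : ∀ n (z : 𝕜), ‖z‖ ≤ r → ‖c n * (n * z ^ (n - 1))‖ ≤ ‖c n‖ * (n * r ^ (n - 1)) := by
    intro n z hz
    rw [norm_mul, norm_mul, norm_pow, RCLike.norm_natCast]
    gcongr
  have htermwise := hasDerivAt_tsum_of_isPreconnected (t := Metric.ball (0 : 𝕜) r)
    (g := fun n z => c n * z ^ n) (g' := fun n z => c n * (n * z ^ (n - 1)))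
    (y₀ := y) (y := y) hmajorant Metric.isOpen_ball (convex_ball _ _).isPreconnected
    (fun n z _ => (hasDerivAt_pow n z).const_mul (c n))
    (fun n z hz => hbound n z (by simpa using (Metric.mem_ball.1 hz).le))
    (by simp [hr]) (hc.hasSum y).summable (by simp [hr])
  have hshift : ∑' n, c n * (n * y ^ (n - 1)) = seriesSum (PhaseRetrieval.derivCoeff c) y := by
    rw [Summable.tsum_eq_zero_add (hmajorant.of_norm_bounded fun n => hbound n y (by simp [hr])),
      Nat.cast_zero, zero_mul, mul_zero, zero_add]
    refine tsum_congr fun n => ?_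
    rw [PhaseRetrieval.derivCoeff, Nat.add_sub_cancel]
    push_cast
    ring
  rwa [hshift] at htermwise

theorem deriv_eq (hc : ExpBounded c) : deriv (seriesSum c) = seriesSum (derivCoeff c) :=
  funext fun y => (hc.hasDerivAt y).deriv

theorem differentiable (hc : ExpBounded c) : Differentiable 𝕜 (seriesSum c) :=
  fun y => (hc.hasDerivAt y).differentiableAt

theorem differentiable_deriv (hc : ExpBounded c) : Differentiable 𝕜 (deriv (seriesSum c)) :=
  hc.deriv_eq ▸ hc.derivCoeff.differentiable

theorem hasSum_deriv (hc : ExpBounded c) (y : 𝕜) :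
    HasSum (fun n : ℕ => (n + 1) * c (n + 1) * y ^ n) (deriv (seriesSum c) y) :=
  hc.deriv_eq ▸ hc.derivCoeff.hasSum y

theorem hasSum_mul_deriv (hc : ExpBounded c) (y : 𝕜) :
    HasSum (fun n : ℕ => n * c n * y ^ n) (y * deriv (seriesSum c) y) := by
  rw [← hasSum_nat_add_iff' 1, Finset.sum_range_one, Nat.cast_zero, zero_mul, zero_mul, sub_zero]
  refine ((hc.hasSum_deriv y).mul_left y).congr_fun fun n => ?_
  push_cast
  ring

theorem hasSum_deriv_mul_deriv (hc : ExpBounded c) (y : 𝕜) :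
    HasSum (fun n : ℕ => ((n : 𝕜) + 1) ^ 2 * c (n + 1) * y ^ n)
      (y * deriv (deriv (seriesSum c)) y + deriv (seriesSum c) y) := by
  have h := (hc.derivCoeff.hasSum_mul_deriv y).add (hc.derivCoeff.hasSum y)
  rw [← hc.deriv_eq] at h
  refine h.congr_fun fun n => ?_
  rw [PhaseRetrieval.derivCoeff]
  ring

theorem norm_seriesSum_sub_sum_range_le (hc : ExpBounded c) {y : 𝕜} (hy : ‖y‖ ≤ 1) (N : ℕ) :
    ‖seriesSum c y - ∑ i ∈ Finset.range N, c i * y ^ i‖ ≤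
      ‖y‖ ^ N * (exp 1 - ∑ i ∈ Finset.range N, 1 / (i.factorial : ℝ)) := by
  have hexp : HasSum (fun n : ℕ => 1 / (n.factorial : ℝ)) (exp 1) := by
    simpa [Real.exp_eq_exp_ℝ] using NormedSpace.expSeries_div_hasSum_exp (𝔸 := ℝ) 1
  have htail := ((hasSum_nat_add_iff' N).2 hexp).mul_left (‖y‖ ^ N)
  rw [← ((hasSum_nat_add_iff' N).2 (hc.hasSum y)).tsum_eq]
  refine tsum_of_norm_bounded htail fun n => ?_
  calc ‖c (n + N) * y ^ (n + N)‖ ≤ ‖y‖ ^ (n + N) / ((n + N).factorial : ℝ) := hc.norm_term_le y _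
    _ = ‖y‖ ^ N * (‖y‖ ^ n / ((n + N).factorial : ℝ)) := by ring
    _ ≤ ‖y‖ ^ N * (1 / ((n + N).factorial : ℝ)) := by
      gcongr
      exact pow_le_one₀ (norm_nonneg y) hy

end ExpBounded

end PowerSeries

section Clifford

/-- The coefficients `1 / (n!)²` of the Bessel–Clifford function. -/
def cliffordCoeff (n : ℕ) : ℝ := 1 / (n.factorial : ℝ) ^ 2

/-- The coefficients `hₙ / (n!)²` of the companion of the Bessel–Clifford function, where `hₙ` is
the `n`-th harmonic number. -/
def harmonicCliffordCoeff (n : ℕ) : ℝ := (harmonic n : ℝ) / (n.factorial : ℝ) ^ 2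

/-- The Bessel–Clifford function `A(y) = ∑ yⁿ / (n!)²`. In the variable `y = ∓t²/4` it is
`J₀(t)`, resp. `I₀(t)`, which lets one power series serve both. -/
def clifford : ℝ → ℝ := seriesSum cliffordCoeff

/-- The companion `B(y) = ∑ hₙ yⁿ / (n!)²` of the Bessel–Clifford function, carrying the
non-logarithmic part of `Y₀` and `K₀`. -/
def harmonicClifford : ℝ → ℝ := seriesSum harmonicCliffordCoeff

theorem cliffordCoeff_nonneg (n : ℕ) : 0 ≤ cliffordCoeff n := by
  rw [cliffordCoeff]; positivity

theorem harmonic_cast_nonneg (n : ℕ) : (0 : ℝ) ≤ harmonic n := by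
  rw [harmonic]; push_cast; positivity

theorem harmonic_cast_le_self (n : ℕ) : (harmonic n : ℝ) ≤ n := by
  induction n with
  | zero => simp
  | succ n ih =>
    have : ((n : ℝ) + 1)⁻¹ ≤ 1 := inv_le_one_of_one_le₀ (by linarith [n.cast_nonneg (α := ℝ)])
    rw [harmonic_succ]
    push_cast
    linarith

theorem expBounded_cliffordCoeff : ExpBounded cliffordCoeff := by
  intro n
  have hfac : (1 : ℝ) ≤ n.factorial := by exact_mod_cast n.factorial_pos
  rw [Real.norm_of_nonneg (cliffordCoeff_nonneg n), cliffordCoeff]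
  gcongr
  exact le_self_pow₀ hfac two_ne_zero

theorem expBounded_harmonicCliffordCoeff : ExpBounded harmonicCliffordCoeff := by
  intro n
  have hfac : (0 : ℝ) < n.factorial := by exact_mod_cast n.factorial_pos
  have hle : (harmonic n : ℝ) ≤ n.factorial :=
    (harmonic_cast_le_self n).trans (by exact_mod_cast n.self_le_factorial)
  rw [harmonicCliffordCoeff,
    Real.norm_of_nonneg (div_nonneg (harmonic_cast_nonneg n) (by positivity)), sq, ← div_div]
  gcongr
  exact (div_le_one hfac).2 hle

theorem sq_mul_cliffordCoeff_succ (n : ℕ) :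
    ((n : ℝ) + 1) ^ 2 * cliffordCoeff (n + 1) = cliffordCoeff n := by
  rw [cliffordCoeff, cliffordCoeff, Nat.factorial_succ]
  push_cast
  field_simp

theorem sq_mul_harmonicCliffordCoeff_succ (n : ℕ) :
    ((n : ℝ) + 1) ^ 2 * harmonicCliffordCoeff (n + 1) =
      harmonicCliffordCoeff n + (n + 1) * cliffordCoeff (n + 1) := by
  rw [harmonicCliffordCoeff, harmonicCliffordCoeff, cliffordCoeff, harmonic_succ,
    Nat.factorial_succ]
  push_cast
  field_simp

theorem hasSum_clifford (y : ℝ) : HasSum (fun n => cliffordCoeff n * y ^ n) (clifford y) :=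
  expBounded_cliffordCoeff.hasSum y

theorem hasSum_mul_deriv_clifford (y : ℝ) :
    HasSum (fun n : ℕ => n * cliffordCoeff n * y ^ n) (y * deriv clifford y) :=
  expBounded_cliffordCoeff.hasSum_mul_deriv y

theorem hasSum_harmonicClifford (y : ℝ) :
    HasSum (fun n => harmonicCliffordCoeff n * y ^ n) (harmonicClifford y) :=
  expBounded_harmonicCliffordCoeff.hasSum y

theorem hasDerivAt_clifford (y : ℝ) : HasDerivAt clifford (deriv clifford y) y :=
  (expBounded_cliffordCoeff.differentiable y).hasDerivAt

theorem hasDerivAt_deriv_clifford (y : ℝ) :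
    HasDerivAt (deriv clifford) (deriv (deriv clifford) y) y :=
  (expBounded_cliffordCoeff.differentiable_deriv y).hasDerivAt

theorem hasDerivAt_harmonicClifford (y : ℝ) :
    HasDerivAt harmonicClifford (deriv harmonicClifford y) y :=
  (expBounded_harmonicCliffordCoeff.differentiable y).hasDerivAt

theorem hasDerivAt_deriv_harmonicClifford (y : ℝ) :
    HasDerivAt (deriv harmonicClifford) (deriv (deriv harmonicClifford) y) y :=
  (expBounded_harmonicCliffordCoeff.differentiable_deriv y).hasDerivAt

theorem clifford_zero : clifford 0 = 1 := by
  rw [clifford, seriesSum, tsum_eq_single 0 fun n hn => by simp [hn]]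
  simp [cliffordCoeff]

theorem clifford_ode (y : ℝ) : y * deriv (deriv clifford) y + deriv clifford y = clifford y :=
  (expBounded_cliffordCoeff.hasSum_deriv_mul_deriv y).unique <|
    (hasSum_clifford y).congr_fun fun n => by rw [sq_mul_cliffordCoeff_succ]

theorem harmonicClifford_ode (y : ℝ) :
    y * deriv (deriv harmonicClifford) y + deriv harmonicClifford y =
      harmonicClifford y + deriv clifford y :=
  (expBounded_harmonicCliffordCoeff.hasSum_deriv_mul_deriv y).unique <|
    ((hasSum_harmonicClifford y).add (expBounded_cliffordCoeff.hasSum_deriv y)).congr_fun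
      fun n => by rw [sq_mul_harmonicCliffordCoeff_succ, add_mul]

theorem mul_wronskian_clifford (y : ℝ) :
    y * (clifford y * deriv harmonicClifford y - deriv clifford y * harmonicClifford y) =
      (clifford y ^ 2 - 1) / 2 := by
  have hderiv : ∀ z, HasDerivAt (fun z => z * (clifford z * deriv harmonicClifford z -
      deriv clifford z * harmonicClifford z) - (clifford z ^ 2 - 1) / 2) 0 z := by
    intro z
    have hA := hasDerivAt_clifford z
    convert! ((hasDerivAt_id z).mul ((hA.mul (hasDerivAt_deriv_harmonicClifford z)).sub
      ((hasDerivAt_deriv_clifford z).mul (hasDerivAt_harmonicClifford z)))).sub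
      (((hA.pow 2).sub_const 1).div_const 2) using 1
    simp only [id, Pi.mul_apply, Pi.sub_apply]
    linear_combination harmonicClifford z * clifford_ode z - clifford z * harmonicClifford_ode z
  have hconst := is_const_of_deriv_eq_zero (fun z => (hderiv z).differentiableAt)
    (fun z => (hderiv z).deriv) y 0
  simp only [clifford_zero] at hconst
  linarith

theorem one_add_add_sq_le_clifford {y : ℝ} (hy : 0 ≤ y) : 1 + y + y ^ 2 / 4 ≤ clifford y := by
  have hpartial := sum_le_hasSum (Finset.range 3)
    (fun n _ => mul_nonneg (cliffordCoeff_nonneg n) (pow_nonneg hy n)) (hasSum_clifford y)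
  simp only [Finset.sum_range_succ, Finset.sum_range_zero, cliffordCoeff, Nat.factorial] at hpartial
  norm_num at hpartial
  linarith

theorem clifford_sub_one_le_mul_deriv {y : ℝ} (hy : 0 ≤ y) :
    clifford y - 1 ≤ y * deriv clifford y := by
  have hshift := (hasSum_nat_add_iff' 1).2 (hasSum_clifford y)
  have hshift' := (hasSum_nat_add_iff' 1).2 (hasSum_mul_deriv_clifford y)
  simp only [Finset.sum_range_one, cliffordCoeff, Nat.factorial_zero, Nat.cast_zero, Nat.cast_one,
    pow_zero, one_pow, div_one, mul_one, sub_zero] at hshift hshift'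
  refine hasSum_le (fun n => ?_) hshift hshift'
  push_cast
  have : (0 : ℝ) ≤ 1 / ((n + 1).factorial : ℝ) ^ 2 * y ^ (n + 1) := by positivity
  nlinarith [n.cast_nonneg (α := ℝ)]

end Clifford

section BesselEquation

/-- `f` solves the Bessel equation `u'' + u'/t = σ u` of order zero on `(0, ∞)`. The case `σ = -1`
is the ordinary Bessel equation and `σ = 1` the modified one. -/
structure IsBesselSolution (σ : ℝ) (f : ℝ → ℝ) : Prop where
  differentiableAt : ∀ ⦃t : ℝ⦄, 0 < t → DifferentiableAt ℝ f t
  hasDerivAt_deriv : ∀ ⦃t : ℝ⦄, 0 < t → HasDerivAt (deriv f) (σ * f t - deriv f t / t) t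

namespace IsBesselSolution

variable {σ : ℝ} {f g : ℝ → ℝ}

theorem hasDerivAt (hf : IsBesselSolution σ f) {t : ℝ} (ht : 0 < t) :
    HasDerivAt f (deriv f t) t :=
  (hf.differentiableAt ht).hasDerivAt

theorem of_hasDerivAt {f' : ℝ → ℝ} (hf : ∀ t, 0 < t → HasDerivAt f (f' t) t)
    (hf' : ∀ t, 0 < t → HasDerivAt f' (σ * f t - f' t / t) t) : IsBesselSolution σ f where
  differentiableAt t ht := (hf t ht).differentiableAt
  hasDerivAt_deriv t ht := by
    have heq : deriv f =ᶠ[𝓝 t] f' :=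
      (eventually_gt_nhds ht).mono fun s hs => (hf s hs).deriv
    rw [heq.eq_of_nhds]
    exact (hf' t ht).congr_of_eventuallyEq heq

theorem const_mul (hf : IsBesselSolution σ f) (r : ℝ) :
    IsBesselSolution σ fun t => r * f t :=
  of_hasDerivAt (f' := fun t => r * deriv f t) (fun _ ht => (hf.hasDerivAt ht).const_mul r)
    fun t ht => by
      convert! (hf.hasDerivAt_deriv ht).const_mul r using 1
      ring

theorem sub (hf : IsBesselSolution σ f) (hg : IsBesselSolution σ g) :
    IsBesselSolution σ fun t => f t - g t :=
  of_hasDerivAt (f' := fun t => deriv f t - deriv g t)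
    (fun _ ht => (hf.hasDerivAt ht).sub (hg.hasDerivAt ht)) fun t ht => by
      convert! (hf.hasDerivAt_deriv ht).sub (hg.hasDerivAt_deriv ht) using 1
      ring

theorem antitoneOn_energy (hf : IsBesselSolution σ f) (hcont : ContinuousOn f (Ici 0))
    (hcont' : ContinuousOn (deriv f) (Ici 0)) :
    AntitoneOn (fun t => deriv f t ^ 2 - σ * f t ^ 2) (Ici 0) := by
  refine antitoneOn_of_hasDerivWithinAt_nonpos (f' := fun t => -(2 * deriv f t ^ 2 / t))
    (convex_Ici 0) ((hcont'.pow 2).sub ((hcont.pow 2).const_mul σ)) (fun t ht => ?_) fun t ht => ?_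
  all_goals rw [interior_Ici, mem_Ioi] at ht
  · convert! (((hf.hasDerivAt_deriv ht).pow 2).sub
      (((hf.hasDerivAt ht).pow 2).const_mul σ)).hasDerivWithinAt using 1
    field_simp
    ring
  · exact neg_nonpos.2 (by positivity)

end IsBesselSolution

/-- The solution `A(σ t² / 4)` of `u'' + u'/t = σ u` that is regular at `0`. -/
def besselReg (σ t : ℝ) : ℝ := clifford (σ * t ^ 2 / 4)

/-- The logarithmic factor `log (t/2) + γ` of the second solution. -/
def logTerm (t : ℝ) : ℝ := Real.log (t / 2) + Real.eulerMascheroniConstant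

/-- The solution of `u'' + u'/t = σ u` with a logarithmic singularity at `0`, given by the Frobenius
method. -/
def besselLog (σ t : ℝ) : ℝ := logTerm t * besselReg σ t - harmonicClifford (σ * t ^ 2 / 4)

variable (σ : ℝ) {t : ℝ}

theorem hasDerivAt_mul_sq_div_four (t : ℝ) :
    HasDerivAt (fun t : ℝ => σ * t ^ 2 / 4) (σ * t / 2) t := by
  convert! ((hasDerivAt_pow 2 t).const_mul σ).div_const 4 using 1
  push_cast
  ring

theorem hasDerivAt_besselReg (t : ℝ) :
    HasDerivAt (besselReg σ) (σ * t / 2 * deriv clifford (σ * t ^ 2 / 4)) t := by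
  convert! (hasDerivAt_clifford _).comp t (hasDerivAt_mul_sq_div_four σ t) using 1
  ring

theorem hasDerivAt_logTerm (ht : 0 < t) : HasDerivAt logTerm (1 / t) t := by
  convert! (((hasDerivAt_id t).div_const 2).log (by simpa using ht.ne')).add_const _ using 1
  simp only [id]
  field_simp

theorem hasDerivAt_besselLog (ht : 0 < t) :
    HasDerivAt (besselLog σ) (besselReg σ t / t + logTerm t * deriv (besselReg σ) t -
      σ * t / 2 * deriv harmonicClifford (σ * t ^ 2 / 4)) t := by
  convert! ((hasDerivAt_logTerm ht).mul (hasDerivAt_besselReg σ t)).sub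
    ((hasDerivAt_harmonicClifford _).comp t (hasDerivAt_mul_sq_div_four σ t)) using 1
  rw [(hasDerivAt_besselReg σ t).deriv]
  ring

theorem isBesselSolution_besselReg : IsBesselSolution σ (besselReg σ) := by
  refine .of_hasDerivAt (fun t _ => hasDerivAt_besselReg σ t) fun t ht => ?_
  convert! ((hasDerivAt_id t).const_mul (σ / 2)).mul
    ((hasDerivAt_deriv_clifford _).comp t (hasDerivAt_mul_sq_div_four σ t)) using 1
  · funext s
    simp only [id, Pi.mul_apply, Function.comp]
    ring
  · rw [besselReg, ← clifford_ode]
    simp only [id, Function.comp]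
    field_simp
    ring

theorem isBesselSolution_besselLog : IsBesselSolution σ (besselLog σ) := by
  refine .of_hasDerivAt (fun t ht => hasDerivAt_besselLog σ ht) fun t ht => ?_
  have hreg := isBesselSolution_besselReg σ
  convert! (((hreg.hasDerivAt ht).div (hasDerivAt_id t) ht.ne').add
    ((hasDerivAt_logTerm ht).mul (hreg.hasDerivAt_deriv ht))).sub
    (((hasDerivAt_id t).const_mul (σ / 2)).mul
    ((hasDerivAt_deriv_harmonicClifford _).comp t (hasDerivAt_mul_sq_div_four σ t))) using 1
  · funext s
    simp only [id, Pi.mul_apply, Pi.div_apply, Pi.add_apply, Pi.sub_apply, Function.comp]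
    ring
  · have hode := harmonicClifford_ode (σ * t ^ 2 / 4)
    rw [besselLog, (hasDerivAt_besselReg σ t).deriv, ← sub_eq_zero]
    simp only [id, Function.comp]
    field_simp
    linear_combination (4 : ℝ) * σ * t ^ 2 * hode

theorem mul_wronskian_bessel (ht : 0 < t) :
    t * (besselReg σ t * deriv (besselLog σ) t - deriv (besselReg σ) t * besselLog σ t) = 1 := by
  have hclifford := mul_wronskian_clifford (σ * t ^ 2 / 4)
  rw [(hasDerivAt_besselLog σ ht).deriv, (hasDerivAt_besselReg σ t).deriv, besselLog, besselReg]
  generalize hy : σ * t ^ 2 / 4 = y at hclifford ⊢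
  field_simp
  linear_combination (-4 : ℝ) * hclifford -
    4 * (clifford y * deriv harmonicClifford y - deriv clifford y * harmonicClifford y) * hy

theorem besselReg_zero : besselReg σ 0 = 1 := by
  simp [besselReg, clifford_zero]

theorem deriv_besselReg_sq_sub_le (ht : 0 ≤ t) :
    deriv (besselReg σ) t ^ 2 - σ * besselReg σ t ^ 2 ≤ -σ := by
  have hdiff : Differentiable ℝ (deriv (besselReg σ)) := by
    rw [funext fun t => (hasDerivAt_besselReg σ t).deriv]
    have : Differentiable ℝ (deriv clifford) :=
      fun y => (hasDerivAt_deriv_clifford y).differentiableAt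
    fun_prop
  have hcont : Continuous (besselReg σ) :=
    continuous_iff_continuousAt.2 fun t => (hasDerivAt_besselReg σ t).continuousAt
  have henergy := (isBesselSolution_besselReg σ).antitoneOn_energy hcont.continuousOn
    hdiff.continuous.continuousOn self_mem_Ici ht ht
  simpa [besselReg_zero, (hasDerivAt_besselReg σ 0).deriv] using henergy

end BesselEquation

section SpecialValues

/-- The modified Bessel function of the first kind `I₀`. -/
def besselI0 : ℝ → ℝ := besselReg 1

/-- The modified Bessel function of the second kind `K₀`, on the positive half-line. -/
def besselK0 (t : ℝ) : ℝ := -besselLog 1 t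

theorem besselJ0_eq_clifford {z : ℂ} {y : ℝ} (hz : z ^ 2 / 4 = ((-y : ℝ) : ℂ)) :
    besselJ0 z = (clifford y : ℂ) := by
  rw [besselJ0, hz, clifford, seriesSum, Complex.ofReal_tsum]
  refine tsum_congr fun n => ?_
  rw [cliffordCoeff, ← mul_pow]
  push_cast
  ring

theorem besselY0_eq_clifford {z : ℂ} {y : ℝ} (hz : z ^ 2 / 4 = ((-y : ℝ) : ℂ)) :
    besselY0 z = 2 / (π : ℂ) * ((Complex.log (z / 2) + (eulerMascheroniConstant : ℂ)) *
      (clifford y : ℂ) - (harmonicClifford y : ℂ)) := by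
  have htail : ∑' n : ℕ, (-1) ^ n * ((harmonic n : ℚ) : ℂ) * (z ^ 2 / 4) ^ n /
      ((n.factorial : ℂ) ^ 2) = (harmonicClifford y : ℂ) := by
    rw [hz, harmonicClifford, seriesSum, Complex.ofReal_tsum]
    refine tsum_congr fun n => ?_
    rw [harmonicCliffordCoeff, mul_right_comm, ← mul_pow]
    push_cast
    ring
  rw [besselY0, htail, besselJ0_eq_clifford hz]
  ring

theorem J0_eq_besselReg (t : ℝ) : J0 t = besselReg (-1) t := by
  rw [J0, besselJ0_eq_clifford (y := -1 * t ^ 2 / 4) (by push_cast; ring), Complex.ofReal_re,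
    besselReg]

theorem Y0_eq_besselLog {t : ℝ} (ht : 0 < t) : Y0 t = 2 / π * besselLog (-1) t := by
  have hlog : Complex.log ((t : ℂ) / 2) = (Real.log (t / 2) : ℂ) := by
    rw [Complex.ofReal_log (by positivity)]
    push_cast
    rfl
  have hY : besselY0 t = ((2 / π * besselLog (-1) t : ℝ) : ℂ) := by
    rw [besselY0_eq_clifford (y := -1 * t ^ 2 / 4) (by push_cast; ring), hlog, besselLog, logTerm,
      besselReg]
    push_cast
    rfl
  rw [Y0, hY, Complex.ofReal_re]

theorem H0_eq_besselK0 {t : ℝ} (ht : 0 < t) : H0 t = 2 / π * besselK0 t := by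
  have hz : (Complex.I * (t : ℂ)) ^ 2 / 4 = ((-(1 * t ^ 2 / 4) : ℝ) : ℂ) := by
    rw [mul_pow, Complex.I_sq]
    push_cast
    ring
  have hlog : Complex.log (Complex.I * (t : ℂ) / 2) =
      (Real.log (t / 2) : ℂ) + (π : ℂ) / 2 * Complex.I := by
    have harg : Complex.I * (t : ℂ) / 2 = ((t / 2 : ℝ) : ℂ) * Complex.I := by push_cast; ring
    rw [harg, Complex.log_ofReal_mul (by positivity) Complex.I_ne_zero, Complex.log_I]
  have hpi : (π : ℂ) ≠ 0 := by exact_mod_cast Real.pi_ne_zero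
  have hH : Complex.I * hankelH10 (Complex.I * t) = ((2 / π * besselK0 t : ℝ) : ℂ) := by
    rw [hankelH10, besselJ0_eq_clifford hz, besselY0_eq_clifford hz, hlog, besselK0, besselLog,
      logTerm, besselReg, mul_add, ← mul_assoc, Complex.I_mul_I]
    push_cast
    field_simp
    ring
  rw [H0, hH, Complex.ofReal_re]

theorem abs_J0_le_one (t : ℝ) : |J0 t| ≤ 1 := by
  have heven : J0 t = J0 |t| := by simp only [J0_eq_besselReg, besselReg, sq_abs]
  rw [heven, ← sq_le_one_iff_abs_le_one, J0_eq_besselReg]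
  nlinarith [deriv_besselReg_sq_sub_le (-1) (abs_nonneg t), sq_nonneg (deriv (besselReg (-1)) |t|)]

end SpecialValues

section ModifiedBessel

variable {t : ℝ}

theorem hasDerivAt_besselI0 (t : ℝ) : HasDerivAt besselI0 (deriv besselI0 t) t :=
  (hasDerivAt_besselReg 1 t).differentiableAt.hasDerivAt

theorem deriv_besselI0_eq (t : ℝ) :
    deriv besselI0 t = t / 2 * deriv clifford ((t / 2) ^ 2) := by
  rw [besselI0, (hasDerivAt_besselReg 1 t).deriv]
  ring_nf

theorem besselI0_eq_clifford (t : ℝ) : besselI0 t = clifford ((t / 2) ^ 2) := by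
  rw [besselI0, besselReg]
  ring_nf

theorem one_add_pow_four_le_besselI0 (t : ℝ) : 1 + t ^ 4 / 64 ≤ besselI0 t := by
  have hpartial := one_add_add_sq_le_clifford (sq_nonneg (t / 2))
  rw [besselI0_eq_clifford]
  nlinarith [sq_nonneg t]

theorem besselI0_pos (t : ℝ) : 0 < besselI0 t :=
  lt_of_lt_of_le (by positivity) (one_add_pow_four_le_besselI0 t)

theorem deriv_besselI0_le (ht : 0 ≤ t) : deriv besselI0 t ≤ besselI0 t := by
  have henergy : deriv besselI0 t ^ 2 - 1 * besselI0 t ^ 2 ≤ -1 := deriv_besselReg_sq_sub_le 1 ht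
  exact le_of_abs_le (abs_le_of_sq_le_sq (by linarith) (besselI0_pos t).le)

theorem besselI0_le_mul_deriv (ht : 2 ≤ t) : besselI0 t ≤ t * deriv besselI0 t := by
  have hy : 1 ≤ (t / 2) ^ 2 := one_le_pow₀ (by linarith)
  have hpartial := one_add_add_sq_le_clifford (sq_nonneg (t / 2))
  have hderiv := clifford_sub_one_le_mul_deriv (sq_nonneg (t / 2))
  calc besselI0 t = clifford ((t / 2) ^ 2) := besselI0_eq_clifford t
    _ ≤ 2 * ((t / 2) ^ 2 * deriv clifford ((t / 2) ^ 2)) := by nlinarith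
    _ = t * deriv besselI0 t := by rw [deriv_besselI0_eq]; ring

theorem tendsto_besselI0_atTop : Tendsto besselI0 atTop atTop := by
  refine tendsto_atTop_mono' _ ?_ tendsto_id
  filter_upwards [eventually_ge_atTop 4] with t ht
  have hcube : (4 : ℝ) ^ 3 ≤ t ^ 3 := by gcongr
  have hquartic := one_add_pow_four_le_besselI0 t
  rw [id]
  nlinarith

theorem harmonic_sub_log_le {s : ℝ} (hs : 0 < s) (n : ℕ) :
    (harmonic n : ℝ) - eulerMascheroniConstant - Real.log s ≤ n / s + 1 / s - 1 := by
  have hγ := (eulerMascheroniSeq_lt_eulerMascheroniConstant n).le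
  have hn : (0 : ℝ) < (n : ℝ) + 1 := by positivity
  have hlog := Real.log_le_sub_one_of_pos (div_pos hn hs)
  rw [eulerMascheroniSeq] at hγ
  rw [Real.log_div hn.ne' hs.ne', add_div] at hlog
  linarith

theorem le_harmonic_sub_log {s : ℝ} (hs : 0 < s) (n : ℕ) :
    1 - (s + 1) / (n + 1) ≤ (harmonic n : ℝ) - eulerMascheroniConstant - Real.log s := by
  have hγ := (eulerMascheroniConstant_lt_eulerMascheroniSeq' (n + 1)).le
  have hn : (0 : ℝ) < (n : ℝ) + 1 := by positivity
  have hlog := Real.log_le_sub_one_of_pos (div_pos hs hn)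
  rw [eulerMascheroniSeq', if_neg n.succ_ne_zero, harmonic_succ] at hγ
  push_cast at hγ
  rw [Real.log_div hs.ne' hn.ne'] at hlog
  rw [add_div, one_div]
  linarith

theorem hasSum_besselK0 (t : ℝ) :
    HasSum (fun n => ((harmonic n : ℝ) - eulerMascheroniConstant - Real.log (t / 2)) *
      (cliffordCoeff n * ((t / 2) ^ 2) ^ n)) (besselK0 t) := by
  have hK : besselK0 t = harmonicClifford ((t / 2) ^ 2) - logTerm t * clifford ((t / 2) ^ 2) := by
    rw [besselK0, besselLog, besselReg]
    ring_nf
  rw [hK]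
  refine ((hasSum_harmonicClifford _).sub ((hasSum_clifford _).mul_left _)).congr_fun fun n => ?_
  rw [harmonicCliffordCoeff, cliffordCoeff, logTerm]
  ring

theorem besselK0_le_two_div_mul_besselI0 (ht : 0 < t) : besselK0 t ≤ 2 / t * besselI0 t := by
  have hs : 0 < t / 2 := by positivity
  have hmajorant := ((hasSum_mul_deriv_clifford ((t / 2) ^ 2)).div_const (t / 2)).add
    ((hasSum_clifford ((t / 2) ^ 2)).mul_left (1 / (t / 2) - 1))
  have hle := hasSum_le (fun n => ?_) (hasSum_besselK0 t) hmajorant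
  · calc besselK0 t ≤ (t / 2) ^ 2 * deriv clifford ((t / 2) ^ 2) / (t / 2) +
          (1 / (t / 2) - 1) * clifford ((t / 2) ^ 2) := hle
      _ = deriv besselI0 t + (2 / t - 1) * besselI0 t := by
        rw [deriv_besselI0_eq, besselI0_eq_clifford]
        field_simp
      _ ≤ 2 / t * besselI0 t := by linarith [deriv_besselI0_le ht.le]
  · calc _ ≤ (n / (t / 2) + 1 / (t / 2) - 1) * (cliffordCoeff n * ((t / 2) ^ 2) ^ n) :=
          mul_le_mul_of_nonneg_right (harmonic_sub_log_le hs n)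
            (mul_nonneg (cliffordCoeff_nonneg n) (by positivity))
      _ = _ := by ring

theorem neg_two_div_mul_besselI0_le_besselK0 (ht : 0 < t) : -(2 / t * besselI0 t) ≤ besselK0 t := by
  have hs : 0 < t / 2 := by positivity
  have hminorant := (hasSum_clifford ((t / 2) ^ 2)).sub
    ((expBounded_cliffordCoeff.hasSum_deriv ((t / 2) ^ 2)).mul_left (t / 2 + 1))
  have hle := hasSum_le (fun n => ?_) hminorant (hasSum_besselK0 t)
  · calc -(2 / t * besselI0 t) ≤ besselI0 t - (1 + 2 / t) * deriv besselI0 t := by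
          nlinarith [deriv_besselI0_le ht.le, div_pos two_pos ht]
      _ = clifford ((t / 2) ^ 2) - (t / 2 + 1) * deriv clifford ((t / 2) ^ 2) := by
        rw [deriv_besselI0_eq, besselI0_eq_clifford]
        field_simp
      _ ≤ besselK0 t := hle
  · calc _ = (1 - (t / 2 + 1) / (n + 1)) * (cliffordCoeff n * ((t / 2) ^ 2) ^ n) := by
          rw [← sq_mul_cliffordCoeff_succ]
          field_simp
      _ ≤ _ := mul_le_mul_of_nonneg_right (le_harmonic_sub_log hs n)
            (mul_nonneg (cliffordCoeff_nonneg n) (by positivity))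

theorem tendsto_besselK0_div_besselI0 :
    Tendsto (fun t => besselK0 t / besselI0 t) atTop (𝓝 0) := by
  have hlim : Tendsto (fun t : ℝ => 2 / t) atTop (𝓝 0) := tendsto_const_nhds.div_atTop tendsto_id
  refine squeeze_zero_norm' ?_ hlim
  filter_upwards [eventually_gt_atTop 0] with t ht
  rw [Real.norm_eq_abs, abs_div, abs_of_pos (besselI0_pos t), div_le_iff₀ (besselI0_pos t)]
  exact abs_le.2 ⟨neg_two_div_mul_besselI0_le_besselK0 ht, besselK0_le_two_div_mul_besselI0 ht⟩

theorem hasDerivAt_besselK0_div_besselI0 (ht : 0 < t) :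
    HasDerivAt (fun t => besselK0 t / besselI0 t) (-(1 / (t * besselI0 t ^ 2))) t := by
  have hI := (besselI0_pos t).ne'
  convert! ((isBesselSolution_besselLog 1).hasDerivAt ht).neg.div (hasDerivAt_besselI0 t) hI using 1
  have hwronskian : t * (besselI0 t * deriv (besselLog 1) t - deriv besselI0 t * besselLog 1 t) =
      1 := mul_wronskian_bessel 1 ht
  rw [Pi.neg_apply]
  field_simp
  linarith

theorem le_of_tendsto_of_deriv_nonpos {g g' : ℝ → ℝ} {b l : ℝ}
    (hg : ∀ t, b ≤ t → HasDerivAt g (g' t) t) (hg' : ∀ t, b ≤ t → g' t ≤ 0)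
    (hlim : Tendsto g atTop (𝓝 l)) : l ≤ g b := by
  have hanti : AntitoneOn g (Ici b) := antitoneOn_of_hasDerivWithinAt_nonpos (convex_Ici b)
    (fun t ht => (hg t ht).continuousAt.continuousWithinAt)
    (fun t ht => (hg t (interior_subset ht)).hasDerivWithinAt)
    (fun t ht => hg' t (interior_subset ht))
  refine le_of_tendsto hlim ?_
  filter_upwards [eventually_ge_atTop b] with t ht
  exact hanti self_mem_Ici ht ht

theorem besselK0_nonneg (ht : 0 < t) : 0 ≤ besselK0 t := by
  have hquotient : 0 ≤ besselK0 t / besselI0 t := by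
    refine le_of_tendsto_of_deriv_nonpos (g := fun s => besselK0 s / besselI0 s)
      (fun s hs => hasDerivAt_besselK0_div_besselI0 (ht.trans_le hs)) (fun s hs => ?_)
      tendsto_besselK0_div_besselI0
    have := ht.trans_le hs
    exact neg_nonpos.2 (by positivity)
  simpa using (le_div_iff₀ (besselI0_pos t)).1 hquotient

theorem hasDerivAt_half_div_besselI0_sq (t : ℝ) :
    HasDerivAt (fun t => 1 / 2 / besselI0 t ^ 2) (-(deriv besselI0 t / besselI0 t ^ 3)) t := by
  have hI := (besselI0_pos t).ne'
  convert! (hasDerivAt_const t (1 / 2 : ℝ)).div ((hasDerivAt_besselI0 t).pow 2)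
    (pow_ne_zero 2 hI) using 1
  rw [Pi.pow_apply]
  field_simp
  ring

theorem besselK0_le_one_div_two_mul_besselI0 (ht : 2 ≤ t) :
    besselK0 t ≤ 1 / (2 * besselI0 t) := by
  have hlim : Tendsto (fun t => 1 / 2 / besselI0 t ^ 2 - besselK0 t / besselI0 t) atTop (𝓝 0) := by
    have hsq : Tendsto (fun t => 1 / 2 / besselI0 t ^ 2) atTop (𝓝 0) :=
      tendsto_const_nhds.div_atTop ((tendsto_pow_atTop two_ne_zero).comp tendsto_besselI0_atTop)
    simpa only [sub_zero] using hsq.sub tendsto_besselK0_div_besselI0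
  have hquotient : besselK0 t / besselI0 t ≤ 1 / 2 / besselI0 t ^ 2 := by
    refine sub_nonneg.1 (le_of_tendsto_of_deriv_nonpos (b := t)
      (g := fun s => 1 / 2 / besselI0 s ^ 2 - besselK0 s / besselI0 s)
      (fun s hs => (hasDerivAt_half_div_besselI0_sq s).sub
        (hasDerivAt_besselK0_div_besselI0 (two_pos.trans_le (ht.trans hs))))
      (fun s hs => ?_) hlim)
    have hI := besselI0_pos s
    have hs0 : 0 < s := by linarith
    rw [sub_neg_eq_add, neg_add_nonpos_iff, div_le_div_iff₀ (by positivity) (by positivity)]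
    nlinarith [besselI0_le_mul_deriv (ht.trans hs), pow_pos hI 2]
  have hI := besselI0_pos t
  calc besselK0 t = besselK0 t / besselI0 t * besselI0 t := by field_simp
    _ ≤ 1 / 2 / besselI0 t ^ 2 * besselI0 t := by gcongr
    _ = 1 / (2 * besselI0 t) := by field_simp

theorem abs_H0_le (ht : 2 ≤ t) : |H0 t| ≤ 2 / π * (32 / t ^ 4) := by
  have ht0 : 0 < t := by linarith
  have hI := besselI0_pos t
  have hquartic := one_add_pow_four_le_besselI0 t
  rw [H0_eq_besselK0 ht0, abs_of_nonneg (mul_nonneg (by positivity) (besselK0_nonneg ht0))]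
  gcongr
  refine (besselK0_le_one_div_two_mul_besselI0 ht).trans ?_
  rw [div_le_div_iff₀ (by positivity) (by positivity)]
  linarith

end ModifiedBessel

section Oscillation

namespace IsBesselSolution

variable {σ : ℝ} {f : ℝ → ℝ} {p q t : ℝ}

theorem monotoneOn_sq_mul_energy (hf : IsBesselSolution σ f) (hσ : σ ≤ 0) :
    MonotoneOn (fun t => t ^ 2 * (deriv f t ^ 2 - σ * f t ^ 2)) (Ioi 0) := by
  have hderiv : ∀ t, 0 < t → HasDerivAt (fun t => t ^ 2 * (deriv f t ^ 2 - σ * f t ^ 2))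
      (-σ * (2 * t * f t ^ 2)) t := by
    intro t ht
    convert! (hasDerivAt_pow 2 t).mul (((hf.hasDerivAt_deriv ht).pow 2).sub
      (((hf.hasDerivAt ht).pow 2).const_mul σ)) using 1
    simp only [Pi.sub_apply, Pi.pow_apply]
    field_simp
    ring
  refine monotoneOn_of_hasDerivWithinAt_nonneg (convex_Ioi 0)
    (fun t ht => (hderiv t ht).continuousAt.continuousWithinAt)
    (fun t ht => (hderiv t (interior_subset ht)).hasDerivWithinAt) fun t ht => ?_
  have : 0 < t := interior_subset ht
  exact mul_nonneg (by linarith) (by positivity)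

theorem abs_deriv_div_le (hf : IsBesselSolution (-1) f) (hp : 0 < p) (hq : f q = 0)
    (ht : t ∈ Icc p q) : |deriv f t / t| ≤ q * |deriv f q| / p ^ 2 := by
  have ht0 : 0 < t := hp.trans_le ht.1
  have hq0 : 0 < q := ht0.trans_le ht.2
  have hmono := hf.monotoneOn_sq_mul_energy (by norm_num) ht0 hq0 ht.2
  simp only [hq] at hmono
  have hsq : (t * deriv f t) ^ 2 ≤ (q * deriv f q) ^ 2 := by nlinarith [sq_nonneg (t * f t)]
  calc |deriv f t / t| = |t * deriv f t| / t ^ 2 := by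
        rw [abs_div, abs_mul, abs_of_pos ht0]
        field_simp
    _ ≤ |q * deriv f q| / p ^ 2 :=
      div_le_div₀ (abs_nonneg _) (sq_le_sq.1 hsq) (by positivity)
        (pow_le_pow_left₀ hp.le ht.1 2)
    _ = q * |deriv f q| / p ^ 2 := by rw [abs_mul, abs_of_pos hq0]

theorem mul_abs_sin_sub_le (hf : IsBesselSolution (-1) f) (hp : 0 < p) (hpq : p ≤ q)
    (hq : f q = 0) :
    |deriv f q| * (|sin (q - p)| - q * (q - p) / p ^ 2) ≤ |f p| := by
  -- The derivative of `f cos(· - p) - f' sin(· - p)` consists of the damping term `f'/t` alone.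
  have hphase : ∀ t ∈ Icc p q, HasDerivWithinAt
      (fun t => f t * cos (t - p) - deriv f t * sin (t - p))
      (deriv f t / t * sin (t - p)) (Icc p q) t := by
    intro t ht
    have ht0 : 0 < t := hp.trans_le ht.1
    have hshift : HasDerivAt (fun t => t - p) 1 t := (hasDerivAt_id t).sub_const p
    refine HasDerivAt.hasDerivWithinAt ?_
    convert! ((hf.hasDerivAt ht0).mul hshift.cos).sub
      ((hf.hasDerivAt_deriv ht0).mul hshift.sin) using 1
    ring
  have hdamping : ∀ t ∈ Icc p q, ‖deriv f t / t * sin (t - p)‖ ≤ q * |deriv f q| / p ^ 2 := by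
    intro t ht
    rw [norm_mul, Real.norm_eq_abs, Real.norm_eq_abs]
    exact (mul_le_of_le_one_right (abs_nonneg _) (abs_sin_le_one _)).trans
      (hf.abs_deriv_div_le hp hq ht)
  have hincrement := (convex_Icc p q).norm_image_sub_le_of_norm_hasDerivWithin_le hphase hdamping
    (left_mem_Icc.2 hpq) (right_mem_Icc.2 hpq)
  simp only [hq, sub_self, cos_zero, sin_zero, zero_mul, mul_one, mul_zero, sub_zero, zero_sub,
    Real.norm_eq_abs, abs_of_nonneg (sub_nonneg.2 hpq)] at hincrement
  calc |deriv f q| * (|sin (q - p)| - q * (q - p) / p ^ 2)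
      = |-(deriv f q * sin (q - p))| - q * |deriv f q| / p ^ 2 * (q - p) := by
        rw [abs_neg, abs_mul]
        ring
    _ ≤ |f p| := by
        linarith [abs_sub_abs_le_abs_sub (-(deriv f q * sin (q - p))) (f p)]

end IsBesselSolution

/-- The common form of the two determinants up to powers of the wave number: `σ = 1` belongs to the
identity and `σ = -1` to the Laplacian, `q` and `p` are the wave number times the two distances. -/
def detCore (σ q p : ℝ) : ℝ := (H0 q + σ * Y0 q) * J0 p - (H0 p + σ * Y0 p) * J0 q

variable {p q σ : ℝ}

theorem le_abs_cross_product (hp : 0 < p) (hpq : p ≤ q) :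
    2 / (π * q) * (|sin (q - p)| - q * (q - p) / p ^ 2) ≤ |J0 q * Y0 p - Y0 q * J0 p| := by
  have hq : 0 < q := hp.trans_le hpq
  set f : ℝ → ℝ := fun t =>
    besselReg (-1) q * besselLog (-1) t - besselLog (-1) q * besselReg (-1) t with hf
  have hreg := isBesselSolution_besselReg (-1)
  have hlog := isBesselSolution_besselLog (-1)
  have hderiv : deriv f q = 1 / q := by
    have hq' : HasDerivAt f _ q :=
      ((hlog.hasDerivAt hq).const_mul _).sub ((hreg.hasDerivAt hq).const_mul _)
    rw [hq'.deriv, eq_div_iff hq.ne']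
    linarith [mul_wronskian_bessel (-1) hq]
  have hsolution := ((hlog.const_mul _).sub (hreg.const_mul _)).mul_abs_sin_sub_le (f := f) hp hpq
    (by rw [hf]; ring)
  rw [hderiv, abs_of_pos (by positivity)] at hsolution
  calc 2 / (π * q) * (|sin (q - p)| - q * (q - p) / p ^ 2)
      = 2 / π * (1 / q * (|sin (q - p)| - q * (q - p) / p ^ 2)) := by field_simp
    _ ≤ 2 / π * |f p| := by gcongr
    _ = |2 / π * f p| := by rw [abs_mul, abs_of_pos (by positivity : 0 < 2 / π)]
    _ = |J0 q * Y0 p - Y0 q * J0 p| := by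
      rw [J0_eq_besselReg, J0_eq_besselReg, Y0_eq_besselLog hp, Y0_eq_besselLog hq, hf]
      ring_nf

theorem one_div_le_abs_cross_product (hp : 5 * π / 2 ≤ p) (hlen : q - p ≤ π / 2)
    (hgap : 37 / 100 * π ≤ q - p) : 1 / (π * q) ≤ |J0 q * Y0 p - Y0 q * J0 p| := by
  have hpi := Real.pi_pos
  have hp0 : 0 < p := by linarith
  have hq0 : 0 < q := by linarith
  have hsin : 37 / 50 ≤ |sin (q - p)| := calc
    (37 / 50 : ℝ) = 2 / π * (37 / 100 * π) := by field_simp; norm_num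
    _ ≤ 2 / π * (q - p) := by gcongr
    _ ≤ sin (q - p) := mul_le_sin (by linarith) hlen
    _ ≤ |sin (q - p)| := le_abs_self _
  have hdamping : q * (q - p) / p ^ 2 ≤ 6 / 25 := by
    rw [div_le_iff₀ (by positivity)]
    nlinarith
  calc 1 / (π * q) = 2 / (π * q) * (1 / 2) := by field_simp
    _ ≤ 2 / (π * q) * (|sin (q - p)| - q * (q - p) / p ^ 2) := by gcongr; linarith
    _ ≤ |J0 q * Y0 p - Y0 q * J0 p| := le_abs_cross_product hp0 (by linarith)

theorem abs_H0_mul_J0_le (hp : 2 ≤ p) : |H0 p * J0 q| ≤ 2 / π * (32 / p ^ 4) := by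
  rw [abs_mul]
  exact (mul_le_of_le_one_right (abs_nonneg _) (abs_J0_le_one q)).trans (abs_H0_le hp)

theorem abs_H0_mul_J0_sub_le (hp : 5 * π / 2 ≤ p) (hpq : p ≤ q) (hlen : q - p ≤ π / 2) :
    |H0 q * J0 p - H0 p * J0 q| ≤ 1 / (2 * (π * q)) := by
  have hpi := Real.pi_gt_d2
  have hp0 : 157 / 20 ≤ p := by linarith
  have hq0 : 0 < q := by linarith
  have hquartic : 256 * q ≤ p ^ 4 := by
    have hcube : (157 / 20 : ℝ) ^ 3 ≤ p ^ 3 := by gcongr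
    nlinarith
  calc |H0 q * J0 p - H0 p * J0 q| ≤ |H0 q * J0 p| + |H0 p * J0 q| := abs_sub _ _
    _ ≤ 2 / π * (32 / q ^ 4) + 2 / π * (32 / p ^ 4) :=
      add_le_add (abs_H0_mul_J0_le (by linarith)) (abs_H0_mul_J0_le (by linarith))
    _ ≤ 2 / π * (32 / p ^ 4) + 2 / π * (32 / p ^ 4) := by gcongr
    _ = 128 / (π * p ^ 4) := by field_simp; norm_num
    _ ≤ 1 / (2 * (π * q)) := by
      rw [div_le_div_iff₀ (by positivity) (by positivity)]
      nlinarith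

theorem one_div_le_abs_detCore (hσ : 1 ≤ |σ|) (hp : 5 * π / 2 ≤ p) (hlen : q - p ≤ π / 2)
    (hgap : 37 / 100 * π ≤ q - p) : 1 / (2 * (π * q)) ≤ |detCore σ q p| := by
  have hY := one_div_le_abs_cross_product hp hlen hgap
  have hH := abs_H0_mul_J0_sub_le hp (by linarith [Real.pi_pos]) hlen
  calc 1 / (2 * (π * q)) = 1 / (π * q) - 1 / (2 * (π * q)) := by field_simp; norm_num
    _ ≤ |J0 q * Y0 p - Y0 q * J0 p| - |H0 q * J0 p - H0 p * J0 q| := by linarith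
    _ ≤ |σ * (J0 q * Y0 p - Y0 q * J0 p)| - |H0 q * J0 p - H0 p * J0 q| := by
      rw [abs_mul]
      gcongr
      exact le_mul_of_one_le_left (abs_nonneg _) hσ
    _ ≤ |σ * (J0 q * Y0 p - Y0 q * J0 p) - (H0 q * J0 p - H0 p * J0 q)| :=
      abs_sub_abs_le_abs_sub _ _
    _ = |detCore σ q p| := by
      rw [← abs_neg, detCore]
      ring_nf

end Oscillation

section LowFrequency

theorem abs_clifford_sub_le {y b : ℝ} (hy : |y| ≤ b) (hb : b ≤ 1) :
    |clifford y - (1 + y + y ^ 2 / 4)| ≤ 11 / 50 * b ^ 3 := by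
  have htaylor := expBounded_cliffordCoeff.norm_seriesSum_sub_sum_range_le (hy.trans hb) 3
  norm_num [Finset.sum_range_succ, cliffordCoeff, Nat.factorial] at htaylor
  have hexp := Real.exp_one_lt_d9
  calc |clifford y - (1 + y + y ^ 2 / 4)| ≤ |y| ^ 3 * (exp 1 - 5 / 2) := by
        convert htaylor using 2
        rw [clifford]
        ring
    _ ≤ b ^ 3 * (11 / 50) :=
      mul_le_mul_of_nonneg (by gcongr) (by linarith) (by positivity) (by norm_num)
    _ = 11 / 50 * b ^ 3 := mul_comm _ _

theorem abs_harmonicClifford_sub_le {y b : ℝ} (hy : |y| ≤ b) (hb : b ≤ 1) :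
    |harmonicClifford y - (y + 3 / 8 * y ^ 2)| ≤ 11 / 50 * b ^ 3 := by
  have htaylor := expBounded_harmonicCliffordCoeff.norm_seriesSum_sub_sum_range_le (hy.trans hb) 3
  norm_num [Finset.sum_range_succ, harmonicCliffordCoeff, cliffordCoeff, harmonic,
    Nat.factorial] at htaylor
  have hexp := Real.exp_one_lt_d9
  calc |harmonicClifford y - (y + 3 / 8 * y ^ 2)| ≤ |y| ^ 3 * (exp 1 - 5 / 2) := htaylor
    _ ≤ b ^ 3 * (11 / 50) :=
      mul_le_mul_of_nonneg (by gcongr) (by linarith) (by positivity) (by norm_num)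
    _ = 11 / 50 * b ^ 3 := mul_comm _ _

variable {t b : ℝ}

theorem J0_eq_clifford (t : ℝ) : J0 t = clifford (-(t ^ 2 / 4)) := by
  rw [J0_eq_besselReg, besselReg, neg_one_mul, neg_div]

theorem H0_add_Y0_eq (ht : 0 < t) :
    H0 t + Y0 t = 2 / π * (harmonicClifford (t ^ 2 / 4) - harmonicClifford (-(t ^ 2 / 4)) -
      logTerm t * (clifford (t ^ 2 / 4) - clifford (-(t ^ 2 / 4)))) := by
  rw [H0_eq_besselK0 ht, Y0_eq_besselLog ht]
  simp only [besselK0, besselLog, besselReg, one_mul, neg_one_mul, neg_div]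
  ring

theorem H0_sub_Y0_eq (ht : 0 < t) :
    H0 t - Y0 t = 2 / π * (harmonicClifford (t ^ 2 / 4) + harmonicClifford (-(t ^ 2 / 4)) -
      logTerm t * (clifford (t ^ 2 / 4) + clifford (-(t ^ 2 / 4)))) := by
  rw [H0_eq_besselK0 ht, Y0_eq_besselLog ht]
  simp only [besselK0, besselLog, besselReg, one_mul, neg_one_mul, neg_div]
  ring

theorem logTerm_le (ht : 0 < t) (hb : t / 2 ≤ b) : logTerm t ≤ b - 1 / 3 := by
  rw [logTerm]
  linarith [Real.log_le_sub_one_of_pos (half_pos ht), Real.eulerMascheroniConstant_lt_two_thirds]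

theorem le_logTerm (hb : 0 < b) (ht : b ≤ t / 2) : 3 / 2 - 1 / b ≤ logTerm t := by
  have hinv : (t / 2)⁻¹ ≤ b⁻¹ := inv_anti₀ hb ht
  rw [logTerm, one_div]
  linarith [Real.one_sub_inv_le_log_of_pos (hb.trans_le ht),
    Real.one_half_lt_eulerMascheroniConstant]

theorem bounds_of_mem_Icc_small (ht : t ∈ Icc (157 / 500) (43 / 125)) :
    97 / 100 ≤ J0 t ∧ H0 t + Y0 t ≤ 2 / π * (7 / 20) ∧ 2 / π * (3 / 10) ≤ H0 t - Y0 t := by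
  obtain ⟨ht₁, ht₂⟩ := ht
  have ht0 : 0 < t := by linarith
  have hlog_le := logTerm_le (b := 43 / 250) ht0 (by linarith)
  have hle_log := le_logTerm (t := t) (b := 157 / 1000) (by norm_num) (by linarith)
  have hx0 : 0 ≤ t ^ 2 / 4 := by positivity
  have hx : t ^ 2 / 4 ≤ 296 / 10000 := by nlinarith
  rw [J0_eq_clifford, H0_add_Y0_eq ht0, H0_sub_Y0_eq ht0]
  generalize t ^ 2 / 4 = x at hx0 hx ⊢
  generalize logTerm t = l at hlog_le hle_log ⊢
  have habs : |x| ≤ 296 / 10000 := by rwa [abs_of_nonneg hx0]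
  have hI := abs_le.1 (abs_clifford_sub_le habs (by norm_num))
  have hJ := abs_le.1 (abs_clifford_sub_le ((abs_neg x).trans_le habs) (by norm_num))
  have hK := abs_le.1 (abs_harmonicClifford_sub_le habs (by norm_num))
  have hY := abs_le.1 (abs_harmonicClifford_sub_le ((abs_neg x).trans_le habs) (by norm_num))
  norm_num at hI hJ hK hY hlog_le hle_log
  have hsq0 : 0 ≤ x ^ 2 := sq_nonneg x
  refine ⟨by linarith, ?_, ?_⟩
  · have hprod : -l * (clifford x - clifford (-x)) ≤ 765 / 157 * (593 / 10000) :=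
      mul_le_mul_of_nonneg (by linarith) (by linarith) (by linarith) (by norm_num)
    gcongr
    linarith
  · have hprod : 4 / 25 * (199 / 100) ≤ -l * (clifford x + clifford (-x)) :=
      mul_le_mul (by linarith) (by linarith) (by norm_num) (by linarith)
    gcongr
    linarith

theorem bounds_of_mem_Icc_large (ht : t ∈ Icc (31 / 20) (1571 / 1000)) :
    2 / 5 ≤ J0 t ∧ 2 / π * (12 / 25) ≤ H0 t + Y0 t ∧ H0 t - Y0 t ≤ 0 := by
  obtain ⟨ht₁, ht₂⟩ := ht
  have ht0 : 0 < t := by linarith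
  have hlog_le := logTerm_le (b := 1571 / 2000) ht0 (by linarith)
  have hle_log := le_logTerm (t := t) (b := 31 / 40) (by norm_num) (by linarith)
  have hx₁ : 3 / 5 ≤ t ^ 2 / 4 := by nlinarith
  have hx₂ : t ^ 2 / 4 ≤ 6171 / 10000 := by nlinarith
  rw [J0_eq_clifford, H0_add_Y0_eq ht0, H0_sub_Y0_eq ht0]
  generalize t ^ 2 / 4 = x at hx₁ hx₂ ⊢
  generalize logTerm t = l at hlog_le hle_log ⊢
  have habs : |x| ≤ 6171 / 10000 := by rwa [abs_of_nonneg (by linarith)]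
  have hI := abs_le.1 (abs_clifford_sub_le habs (by norm_num))
  have hJ := abs_le.1 (abs_clifford_sub_le ((abs_neg x).trans_le habs) (by norm_num))
  have hK := abs_le.1 (abs_harmonicClifford_sub_le habs (by norm_num))
  have hY := abs_le.1 (abs_harmonicClifford_sub_le ((abs_neg x).trans_le habs) (by norm_num))
  norm_num at hI hJ hK hY hlog_le hle_log
  have hsq₁ : 9 / 25 ≤ x ^ 2 := by nlinarith
  have hsq₂ : x ^ 2 ≤ 381 / 1000 := by nlinarith
  refine ⟨by linarith, ?_, mul_nonpos_of_nonneg_of_nonpos (by positivity) ?_⟩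
  · have hprod : l * (clifford x - clifford (-x)) ≤ 453 / 1000 * (134 / 100) :=
      mul_le_mul (by linarith) (by linarith) (by linarith) (by norm_num)
    gcongr
    linarith
  · have hprod : 209 / 1000 * (207 / 100) ≤ l * (clifford x + clifford (-x)) :=
      mul_le_mul (by linarith) (by linarith) (by norm_num) (by linarith)
    linarith

theorem one_div_twenty_le_abs_detCore {p q σ : ℝ} (hσ : |σ| = 1)
    (hq : q ∈ Icc (157 / 500) (43 / 125)) (hp : p ∈ Icc (31 / 20) (1571 / 1000)) :
    1 / 20 ≤ |detCore σ q p| := by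
  obtain ⟨hJq, hadd_q, hsub_q⟩ := bounds_of_mem_Icc_small hq
  obtain ⟨hJp, hadd_p, hsub_p⟩ := bounds_of_mem_Icc_large hp
  have hJp_le := (abs_le.1 (abs_J0_le_one p)).2
  have hpi : 1 / 2 ≤ 2 / π := by
    rw [div_le_div_iff₀ two_pos Real.pi_pos]
    linarith [Real.pi_lt_four]
  generalize 2 / π = w at hpi hadd_q hsub_q hadd_p
  rw [detCore]
  rcases eq_or_eq_neg_of_abs_eq hσ with rfl | rfl
  · rw [one_mul, one_mul]
    refine le_trans ?_ (neg_le_abs _)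
    have hlower : w * (12 / 25) * (97 / 100) ≤ (H0 p + Y0 p) * J0 q :=
      mul_le_mul hadd_p hJq (by norm_num) (le_trans (by linarith) hadd_p)
    have hupper : (H0 q + Y0 q) * J0 p ≤ w * (7 / 20) := calc
      (H0 q + Y0 q) * J0 p ≤ w * (7 / 20) * J0 p := by gcongr
      _ ≤ w * (7 / 20) := mul_le_of_le_one_right (by linarith) hJp_le
    linarith
  · rw [neg_one_mul, neg_one_mul, ← sub_eq_add_neg, ← sub_eq_add_neg]
    refine le_trans ?_ (le_abs_self _)
    have hlower : w * (3 / 10) * (2 / 5) ≤ (H0 q - Y0 q) * J0 p :=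
      mul_le_mul hsub_q hJp (by norm_num) (le_trans (by linarith) hsub_q)
    have hupper : (H0 p - Y0 p) * J0 q ≤ 0 :=
      mul_nonpos_of_nonpos_of_nonneg hsub_p (by linarith)
    linarith

end LowFrequency

section Geometry

/-- The distance from a point of the unit circle to the point at signed distance `μ` from the
centre on an axis, when the cosine of the angle between the point and the axis is `c`. -/
def axisDist (μ c : ℝ) : ℝ := √(1 + μ ^ 2 - 2 * μ * c)

theorem dist_polar {R : ℝ} (hR : 0 ≤ R) (μ ϑ φ : ℝ) :
    dist (polar R ϑ) (polar (μ * R) φ) = R * axisDist μ (cos (ϑ - φ)) := by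
  have hsq : (R * cos ϑ - μ * R * cos φ) ^ 2 + (R * sin ϑ - μ * R * sin φ) ^ 2 =
      R ^ 2 * (1 + μ ^ 2 - 2 * μ * cos (ϑ - φ)) := by
    rw [cos_sub]
    linear_combination R ^ 2 * sin_sq_add_cos_sq ϑ + μ ^ 2 * R ^ 2 * sin_sq_add_cos_sq φ
  rw [EuclideanSpace.dist_eq, Fin.sum_univ_two, Real.dist_eq, Real.dist_eq, sq_abs, sq_abs]
  simp only [polar, PiLp.toLp_apply, Matrix.cons_val_zero, Matrix.cons_val_one]
  rw [hsq, Real.sqrt_mul (sq_nonneg R), Real.sqrt_sq hR, axisDist]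

theorem theta_add_one (m : ℕ) (i : ℝ) : theta m (i + 1) = theta m i + π / m := by
  rw [theta, theta]
  ring

theorem le_cos_sub_theta {m : ℕ} {i ϑ : ℝ} (hm : 10 ≤ m)
    (hϑ : ϑ ∈ Icc (theta m (i - 1)) (theta m (i + 1))) :
    9506 / 10000 ≤ cos (ϑ - theta m i) := by
  have hstep : π / m ≤ 31416 / 100000 := by
    have hm' : (10 : ℝ) ≤ m := by exact_mod_cast hm
    rw [div_le_iff₀ (by linarith)]
    linarith [Real.pi_lt_d4]
  have hprev := theta_add_one m (i - 1)
  rw [sub_add_cancel] at hprev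
  rw [theta_add_one] at hϑ
  have hsq : (ϑ - theta m i) ^ 2 ≤ (31416 / 100000) ^ 2 :=
    sq_le_sq' (by linarith [hϑ.1]) (by linarith [hϑ.2])
  linarith [Real.one_sub_sq_div_two_le_cos (x := ϑ - theta m i)]

theorem exists_dist_source_eq {a τ k : ℝ} {m j : ℕ} (hR : 0 ≤ radius a τ k) (hm : 10 ≤ m)
    {x : EuclideanSpace ℝ (Fin 2)} (hx : x ∈ arc (radius a τ k) m j) :
    ∃ c ∈ Icc (9506 / 10000) 1, ∀ ℓ,
      dist x (source a τ k m j ℓ) = radius a τ k * axisDist (lam a τ k ℓ) c := by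
  obtain ⟨ϑ, hϑ, rfl⟩ := hx
  refine ⟨cos (ϑ - theta m (2 * j - 1)), ⟨le_cos_sub_theta hm ?_, cos_le_one _⟩,
    fun ℓ => dist_polar hR _ _ _⟩
  rwa [sub_add_cancel, sub_sub, one_add_one_eq_two]

variable {c μ ν ε : ℝ}

theorem sq_axisDist (hc : c ∈ Icc (-1) 1) : axisDist μ c ^ 2 = 1 + μ ^ 2 - 2 * μ * c :=
  Real.sq_sqrt (by nlinarith [sq_nonneg (μ - c), hc.1, hc.2])

theorem abs_sub_le_axisDist (hc : c ∈ Icc (-1) 1) : |μ - c| ≤ axisDist μ c :=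
  Real.abs_le_sqrt (by nlinarith [hc.1, hc.2])

theorem axisDist_sub_le (hc : c ∈ Icc (-1) 1) : axisDist μ c - axisDist ν c ≤ |μ - ν| := by
  have hcross : (μ - ν) * (ν - c) ≤ |μ - ν| * axisDist ν c :=
    (le_abs_self _).trans ((abs_mul _ _).trans_le
      (mul_le_mul_of_nonneg_left (abs_sub_le_axisDist hc) (abs_nonneg _)))
  have hν : 0 ≤ axisDist ν c := Real.sqrt_nonneg _
  rw [sub_le_iff_le_add]
  refine abs_le_of_sq_le_sq (?_ : axisDist μ c ^ 2 ≤ _) (by positivity) |>.trans' (le_abs_self _)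
  nlinarith [sq_axisDist (μ := μ) hc, sq_axisDist (μ := ν) hc, sq_abs (μ - ν)]

theorem axisDist_half_mem_Icc (hc : c ∈ Icc (9506 / 10000) 1) :
    axisDist (1 / 2) c ∈ Icc (1 / 2) (5472 / 10000) :=
  ⟨Real.le_sqrt_of_sq_le (by linarith [hc.2]),
    Real.sqrt_le_iff.2 ⟨by norm_num, by linarith [hc.1]⟩⟩

theorem axisDist_neg_three_halves_mem_Icc (hc : c ∈ Icc (9506 / 10000) 1) :
    axisDist (-3 / 2) c ∈ Icc (247 / 100) (5 / 2) :=
  ⟨Real.le_sqrt_of_sq_le (by linarith [hc.1]),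
    Real.sqrt_le_iff.2 ⟨by norm_num, by linarith [hc.2]⟩⟩

theorem mul_le_axisDist_half_sub (hc : c ∈ Icc (9506 / 10000) 1) (hε : ε ∈ Icc 0 (1 / 12)) :
    37 / 50 * ε ≤ axisDist (1 / 2) c - axisDist (1 / 2 + ε) c := by
  have hc' : c ∈ Icc (-1) 1 := ⟨by linarith [hc.1], hc.2⟩
  obtain ⟨hρ_ge, hρ_le⟩ := axisDist_half_mem_Icc hc
  have hρ' : 0 ≤ axisDist (1 / 2 + ε) c := Real.sqrt_nonneg _
  have hprod : (axisDist (1 / 2) c - axisDist (1 / 2 + ε) c) *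
      (axisDist (1 / 2) c + axisDist (1 / 2 + ε) c) = ε * (2 * c - 1 - ε) := by
    linear_combination sq_axisDist (μ := 1 / 2) hc' - sq_axisDist (μ := 1 / 2 + ε) hc'
  have hprod_ge : 817 / 1000 * ε ≤ ε * (2 * c - 1 - ε) := by
    nlinarith [hc.1, hε.1, hε.2]
  have hle : axisDist (1 / 2 + ε) c ≤ axisDist (1 / 2) c := by
    nlinarith [hε.1]
  by_contra! hlt
  nlinarith [hε.1]

end Geometry

section ArcBounds

variable {c σ : ℝ}

theorem one_div_le_abs_detCore_axisDist {κ : ℝ} (hσ : 1 ≤ |σ|) (hκ : 6 * π ≤ κ)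
    (hc : c ∈ Icc (9506 / 10000) 1) :
    1 / (2 * π * κ) ≤ |detCore σ (κ * axisDist (1 / 2) c)
      (κ * axisDist (1 / 2 + π / (2 * κ)) c)| := by
  have hpi := Real.pi_pos
  have hκ0 : 0 < κ := by linarith
  have hshift : π / (2 * κ) ∈ Icc 0 (1 / 12) := by
    refine ⟨by positivity, ?_⟩
    rw [div_le_div_iff₀ (by positivity) (by norm_num)]
    linarith
  have hκshift : κ * (π / (2 * κ)) = π / 2 := by field_simp
  obtain ⟨hρ_ge, hρ_le⟩ := axisDist_half_mem_Icc hc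
  have hgap := mul_le_mul_of_nonneg_left (mul_le_axisDist_half_sub hc hshift) hκ0.le
  have hlen : κ * (axisDist (1 / 2) c - axisDist (1 / 2 + π / (2 * κ)) c) ≤
      κ * (π / (2 * κ)) := by
    gcongr
    refine (axisDist_sub_le ⟨by linarith [hc.1], hc.2⟩).trans_eq ?_
    rw [sub_add_cancel_left, abs_neg, abs_of_nonneg hshift.1]
  rw [mul_left_comm, hκshift, mul_sub] at hgap
  rw [hκshift, mul_sub] at hlen
  have hq_ge : 3 * π ≤ κ * axisDist (1 / 2) c := by nlinarith
  refine le_trans ?_ (one_div_le_abs_detCore hσ (by linarith) hlen (by linarith))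
  rw [mul_assoc]
  gcongr
  exact mul_le_of_le_one_right hκ0.le (by linarith)

theorem one_div_twenty_le_abs_detCore_axisDist (hσ : |σ| = 1) (hc : c ∈ Icc (9506 / 10000) 1) :
    1 / 20 ≤ |detCore σ (π / 5 * axisDist (1 / 2) c) (π / 5 * axisDist (-3 / 2) c)| := by
  have hpi_gt := Real.pi_gt_d4
  have hpi_lt := Real.pi_lt_d4
  obtain ⟨hρ₁, hρ₁'⟩ := axisDist_half_mem_Icc hc
  obtain ⟨hρ₂, hρ₂'⟩ := axisDist_neg_three_halves_mem_Icc hc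
  exact one_div_twenty_le_abs_detCore hσ ⟨by nlinarith, by nlinarith⟩ ⟨by nlinarith, by nlinarith⟩

variable {a τ k : ℝ} {m j : ℕ} {x : EuclideanSpace ℝ (Fin 2)}

theorem k0_lt_pi_div (ha : 0 < a) : k0 a < π / a := by
  rw [k0]
  gcongr
  linarith

theorem one_div_le_abs_detCore_of_mem_arc (hσ : 1 ≤ |σ|) (ha : 0 < a) (hτ : 6 ≤ τ)
    (hk : π / a ≤ k) (hm : 10 ≤ m) (hx : x ∈ arc (radius a τ k) m j) :
    1 / (2 * π * (k * (τ * a))) ≤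
      |detCore σ (k * dist x (source a τ k m j 0)) (k * dist x (source a τ k m j 1))| := by
  have hne : k ≠ k0 a := ((k0_lt_pi_div ha).trans_le hk).ne'
  have hR : radius a τ k = τ * a := if_neg hne
  have hκ : 6 * π ≤ k * (τ * a) := by
    have hka : π ≤ k * a := (div_le_iff₀ ha).1 hk
    nlinarith [Real.pi_pos]
  obtain ⟨c, hc, hdist⟩ := exists_dist_source_eq (hR ▸ by positivity) hm hx
  have hlam : lam a τ k 1 = 1 / 2 + π / (2 * (k * (τ * a))) := by
    simp [lam, hne, hR, mul_assoc]
  rw [hdist, hdist, hR, ← mul_assoc k (τ * a), ← mul_assoc k (τ * a), hlam]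
  exact one_div_le_abs_detCore_axisDist hσ hκ hc

theorem one_div_twenty_le_abs_detCore_of_mem_arc (hσ : |σ| = 1) (ha : 0 < a) (hm : 10 ≤ m)
    (hx : x ∈ arc (radius a τ (k0 a)) m j) :
    1 / 20 ≤ |detCore σ (k0 a * dist x (source a τ (k0 a) m j 0))
      (k0 a * dist x (source a τ (k0 a) m j 1))| := by
  have hR : radius a τ (k0 a) = 6 * a := if_pos rfl
  obtain ⟨c, hc, hdist⟩ := exists_dist_source_eq (hR ▸ by positivity) hm hx
  have hscale : k0 a * (6 * a) = π / 5 := by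
    rw [k0]
    field_simp
    norm_num
  have hlam : lam a τ (k0 a) 1 = -3 / 2 := if_pos rfl
  rw [hdist, hdist, hR, ← mul_assoc _ (6 * a), ← mul_assoc _ (6 * a), hscale, hlam]
  exact one_div_twenty_le_abs_detCore_axisDist hσ hc

end ArcBounds

section Determinant

/-- The sign `σ` for which `coeffA` is, up to sign and powers of `k`, `H₀ + σ Y₀`. -/
def Op.sign : Op → ℝ
  | .ident => 1
  | .laplacian => -1

theorem Op.abs_sign (op : Op) : |op.sign| = 1 := by
  cases op <;> simp [Op.sign]

variable {op : Op} {a τ k C : ℝ} {m j : ℕ} {x : EuclideanSpace ℝ (Fin 2)}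

theorem abs_det_coeffMatrix (hk : 0 < k) :
    |(coeffMatrix op a τ k m j x).det| = k ^ (1 - (op.exponent : ℤ)) *
      |detCore op.sign (k * dist x (source a τ k m j 0)) (k * dist x (source a τ k m j 1))| := by
  have hpow : 0 < k ^ (1 - (op.exponent : ℤ)) := zpow_pos hk _
  rw [← abs_of_pos hpow, ← abs_mul, Matrix.det_fin_two]
  simp only [coeffMatrix, Matrix.of_apply, Matrix.cons_val_zero, Matrix.cons_val_one]
  cases op with
  | ident =>
    rw [← abs_neg]
    congr 1
    simp only [coeffA, coeffB, Op.exponent, Op.sign, detCore]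
    norm_num [zpow_neg]
    field_simp
    ring
  | laplacian =>
    congr 1
    simp only [coeffA, coeffB, Op.exponent, Op.sign, detCore]
    norm_num
    ring

theorem mul_zpow_le_abs_det_coeffMatrix (hk : 0 < k)
    (hcore : C / k ≤ |detCore op.sign (k * dist x (source a τ k m j 0))
      (k * dist x (source a τ k m j 1))|) :
    C * k ^ (-(op.exponent : ℤ)) ≤ |(coeffMatrix op a τ k m j x).det| := by
  rw [abs_det_coeffMatrix hk]
  calc C * k ^ (-(op.exponent : ℤ)) = k ^ (1 - (op.exponent : ℤ)) * (C / k) := by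
        rw [sub_eq_add_neg, zpow_add₀ hk.ne', zpow_one]
        field_simp
    _ ≤ _ := by gcongr

end Determinant

section Solvability

theorem existsUnique_mulVec_eq {n K : Type*} [Fintype n] [DecidableEq n] [Field K]
    {D : Matrix n n K} (hD : D.det ≠ 0) (f : n → K) : ∃! w, D.mulVec w = f := by
  have hunit : IsUnit D := (Matrix.isUnit_iff_isUnit_det D).2 hD.isUnit
  exact Function.Bijective.existsUnique
    ⟨Matrix.mulVec_injective_iff_isUnit.2 hunit, Matrix.mulVec_surjective_iff_isUnit.2 hunit⟩ f

theorem existsUnique_coeff_system {op : Op} {a τ k : ℝ} {m j : ℕ} {x : EuclideanSpace ℝ (Fin 2)}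
    (hdet : (coeffMatrix op a τ k m j x).det ≠ 0) (f : Fin 2 → ℝ) :
    ∃! w : Fin 2 → ℝ, ∀ ℓ, coeffA op k (dist x (source a τ k m j ℓ)) * w 0 +
      coeffB op k (dist x (source a τ k m j ℓ)) * w 1 = f ℓ := by
  simpa only [funext_iff, Matrix.mulVec, dotProduct, Fin.sum_univ_two, coeffMatrix,
    Matrix.of_apply, Matrix.cons_val_zero, Matrix.cons_val_one] using existsUnique_mulVec_eq hdet f

end Solvability

section WaveNumbers

variable {a τ k : ℝ}

theorem k0_pos (ha : 0 < a) : 0 < k0 a := div_pos Real.pi_pos (by positivity)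

theorem exists_div_le_abs_detCore (ha : 0 < a) (hτ : 6 ≤ τ) :
    ∃ C : ℝ, 0 < C ∧ ∀ σ : ℝ, |σ| = 1 → ∀ k : ℝ, k = k0 a ∨ π / a ≤ k →
      ∀ m j : ℕ, 10 ≤ m → ∀ x ∈ arc (radius a τ k) m j,
        C / k ≤ |detCore σ (k * dist x (source a τ k m j 0))
          (k * dist x (source a τ k m j 1))| := by
  have hpi := Real.pi_pos
  have hk0 := k0_pos ha
  refine ⟨min (1 / (2 * π * (τ * a))) (k0 a / 20), by positivity,
    fun σ hσ k hk m j hm x hx => ?_⟩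
  rcases hk with rfl | hk
  · refine le_trans ?_ (one_div_twenty_le_abs_detCore_of_mem_arc hσ ha hm hx)
    rw [div_le_iff₀ hk0]
    exact (min_le_right _ _).trans_eq (by ring)
  · refine le_trans ?_ (one_div_le_abs_detCore_of_mem_arc hσ.ge ha hτ hk hm hx)
    have hk' : 0 < k := (div_pos hpi ha).trans_le hk
    rw [div_le_iff₀ hk']
    exact (min_le_left _ _).trans_eq (by field_simp)

theorem eq_k0_or_pi_div_le_of_mem_admissible {N : ℕ} (ha : 0 < a) (hk : k ∈ admissible a N) :
    k = k0 a ∨ π / a ≤ k := by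
  rcases hk with ⟨l₁, l₂, hl, -, rfl⟩ | hk
  · refine Or.inr (le_mul_of_one_le_right (by positivity) (Real.one_le_sqrt.2 ?_))
    have hsq : (1 : ℤ) ≤ l₁ ^ 2 + l₂ ^ 2 := by
      rcases le_max_iff.1 hl with h | h
      · nlinarith [sq_abs l₁, sq_nonneg l₂]
      · nlinarith [sq_abs l₂, sq_nonneg l₁]
    exact_mod_cast hsq
  · exact Or.inl hk

end WaveNumbers

end PhaseRetrieval

end

open PhaseRetrieval in
theorem mainTheorem2_general (a τ : ℝ) (ha : 0 < a) (hτ : 6 ≤ τ) :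
    ∃ C : ℝ, 0 < C ∧ ∀ (op : Op) (m j : ℕ), 10 ≤ m → ∀ k : ℝ, k = k0 a ∨ Real.pi / a ≤ k →
      ∀ x ∈ arc (radius a τ k) m j,
        C * k ^ (-(op.exponent : ℤ)) ≤ |(coeffMatrix op a τ k m j x).det| ∧
        ∀ f : Fin 2 → ℝ, ∃! w : Fin 2 → ℝ, ∀ ℓ : Fin 2,
          coeffA op k (dist x (source a τ k m j ℓ)) * w 0 +
            coeffB op k (dist x (source a τ k m j ℓ)) * w 1 = f ℓ := by
  obtain ⟨C, hC, hcore⟩ := exists_div_le_abs_detCore ha hτ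
  refine ⟨C, hC, fun op m j hm k hk x hx => ?_⟩
  have hk_pos : 0 < k := by
    rcases hk with rfl | hk
    · exact k0_pos ha
    · exact (div_pos Real.pi_pos ha).trans_le hk
  have hdet := mul_zpow_le_abs_det_coeffMatrix hk_pos (hcore op.sign op.abs_sign k hk m j hm x hx)
  have hdet_ne : (coeffMatrix op a τ k m j x).det ≠ 0 :=
    abs_pos.1 ((by positivity : 0 < C * k ^ (-(op.exponent : ℤ))).trans_le hdet)
  exact ⟨hdet, existsUnique_coeff_system hdet_ne⟩

/-- The constant `C` depends only on `a` and `τ`. The second conjunct is the unique solvability of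
the phase-retrieval system `A_ℓ ξ + B_ℓ η = f_ℓ`, `ℓ = 1, 2`, for every real right-hand side. -/
theorem mainTheorem2 (a τ : ℝ) (ha : 0 < a) (hτ : 6 ≤ τ) :
    ∃ C : ℝ, 0 < C ∧
      ∀ (op : PhaseRetrieval.Op) (m N : ℕ), 10 ≤ m → 1 ≤ N →
        ∀ k ∈ PhaseRetrieval.admissible a N,
        ∀ j : ℕ, 1 ≤ j → j ≤ m →
        ∀ x ∈ PhaseRetrieval.arc (PhaseRetrieval.radius a τ k) m j,
          C * k ^ (-(op.exponent : ℤ)) ≤ |(PhaseRetrieval.coeffMatrix op a τ k m j x).det| ∧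
          ∀ f : Fin 2 → ℝ, ∃! w : Fin 2 → ℝ,
            ∀ ℓ : Fin 2,
              PhaseRetrieval.coeffA op k (dist x (PhaseRetrieval.source a τ k m j ℓ)) * w 0 +
                PhaseRetrieval.coeffB op k (dist x (PhaseRetrieval.source a τ k m j ℓ)) * w 1 =
                f ℓ := by
  obtain ⟨C, hC, hgeneral⟩ := mainTheorem2_general a τ ha hτ
  exact ⟨C, hC, fun op m _ hm _ k hk j _ _ => hgeneral op m j hm k
    (PhaseRetrieval.eq_k0_or_pi_div_le_of_mem_admissible ha hk)⟩
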